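/- A Radon measure on $\mathbb{R}_+ := [0,\infty)$ is a measure $m$ on the Borel sets of $\mathbb{R}_+$ such that every point has an open neighbourhood of finite $m$-measure and $m(A) = \sup\{m(K) : K \subset A \text{ compact}\}$ for every Borel set $A$. A generalised signed Radon measure $\mu$ on $\mathbb{R}_+$ is a set function of the form $\mu(A) = \mu^+(A) - \mu^-(A)$ if both $\mu^+(A), \mu^-(A)$ are finite and $\mu(A) = +\infty$ otherwise, where $\mu^+, \mu^-$ are mutually singular Radon measures on $\mathbb{R}_+$ (both may have infinite mass). Put $|\mu| := \mu^+ + \mu^-$, $F_\mu(0) := 0$ and $F_\mu(x) := \mu([0,x])$ for $x > 0$. If $\int_{\mathbb{R}_+} e^{-\lambda x}\,|\mu|(dx) < \infty$ for all $\lambda > 0$, define for $\lambda > 0$ $$\Psi_\mu(\lambda) := \int_{\mathbb{R}_+} e^{-\lambda x}\,\mu(dx) = \int_{\mathbb{R}_+} e^{-\lambda x}\,\mu^+(dx) - \int_{\mathbb{R}_+} e^{-\lambda x}\,\mu^-(dx), \qquad \Psi_{|\mu|}(\lambda) := \int_{\mathbb{R}_+} e^{-\lambda x}\,|\mu|(dx).$$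 **Theorem (Karamata's Tauberian theorem for generalised signed measures).** Let $\mu$ be a generalised signed Radon measure on $\mathbb{R}_+$ with $\int_{\mathbb{R}_+} e^{-\lambda x}\,|\mu|(dx) < \infty$ for all $\lambda > 0$, and let $\rho \ge 0$ be real. Consider the limit statements $$\lim_{\tau \downarrow 0} \frac{\Psi_\mu(\tau\lambda)}{\Psi_\mu(\tau)} = \frac{1}{\lambda^{\rho}} \quad \text{for all } \lambda > 0, \tag{1}$$ $$\lim_{t \uparrow \infty} \frac{F_\mu(tx)}{F_\mu(t)} = x^{\rho} \quad \text{for all } x > 0, \tag{2}$$ $$\Psi_\mu(t^{-1}) \sim \Gamma(\rho+1)\, F_\mu(t) \quad \text{as } t \to \infty, \tag{3}$$ where (1) includes that $\Psi_\mu(\tau) \neq 0$ for all sufficiently small $\tau > 0$, and (2) includes that $F_\mu(t) \neq 0$ for all sufficiently large $t$. (a) Suppose that $$\liminf_{\tau \downarrow 0} \frac{|\Psi_\mu(\tau)|}{\Psi_{|\mu|}(\tau)} > 0$$ and that $$\limsup_{h \downarrow 0}\, \limsup_{\tau \downarrow 0} \left| \frac{F_\mu(\tau^{-1}(x+h)) -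 F_\mu(\tau^{-1}x)}{\Psi_\mu(\tau)} \right| = 0 \quad \text{for all } x > 0.$$ Then (1) implies (2) and (3). (b) Without these two additional conditions, (2) implies (1) and (3). -/

import Mathlib

open Filter Topology MeasureTheory Asymptotics
open scoped NNReal ENNReal

/-- A Radon measure on the Borel sets of `[0, ∞)`: every point has an open neighbourhood of finite
measure, and every Borel set is inner regular with respect to its compact subsets. -/
structure IsRadonMeasure (m : Measure ℝ≥0) : Prop where
  locallyFinite : ∀ x : ℝ≥0, ∃ U : Set ℝ≥0, IsOpen U ∧ x ∈ U ∧ m U < ∞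
  innerRegular : ∀ A : Set ℝ≥0, MeasurableSet A →
    m A = ⨆ (K : Set ℝ≥0) (_ : IsCompact K) (_ : K ⊆ A), m K

/-- A generalised signed Radon measure on `[0, ∞)`, given by its positive and negative parts, two
mutually singular Radon measures, both of which may have infinite mass. -/
structure GenSignedRadonMeasure where
  pos : Measure ℝ≥0
  neg : Measure ℝ≥0
  pos_radon : IsRadonMeasure pos
  neg_radon : IsRadonMeasure neg
  mutuallySingular : pos ⟂ₘ neg

namespace GenSignedRadonMeasure

open Classical in
/-- The set function `μ`, with values in `ℝ ∪ {∞}`. -/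
noncomputable def value (μ : GenSignedRadonMeasure) (A : Set ℝ≥0) : EReal :=
  if μ.pos A < ∞ ∧ μ.neg A < ∞ then (((μ.pos A).toReal - (μ.neg A).toReal : ℝ) : EReal) else ⊤

/-- The measure `|μ| = μ⁺ + μ⁻`. -/
noncomputable def variation (μ : GenSignedRadonMeasure) : Measure ℝ≥0 :=
  μ.pos + μ.neg

open Classical in
/-- The distribution function: `F 0 = 0` and `F x = μ([0, x])` for `x > 0` (a real number, because
`[0, x]` is compact); it is extended by `0` to negative arguments. -/
noncomputable def distFun (μ : GenSignedRadonMeasure) (x : ℝ) : ℝ :=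
  if x ≤ 0 then 0 else (μ.value {y : ℝ≥0 | (y : ℝ) ≤ x}).toReal

/-- The Laplace transform is finite: `∫ exp (-s x) |μ|(dx) < ∞` for all `s > 0`. -/
def FiniteLaplace (μ : GenSignedRadonMeasure) : Prop :=
  ∀ s : ℝ, 0 < s → ∫⁻ x : ℝ≥0, ENNReal.ofReal (Real.exp (-(s * (x : ℝ)))) ∂μ.variation < ∞

/-- The Laplace transform `Ψ_μ(s) = ∫ exp (-s x) μ(dx)`, the integral against `μ` being the
difference of the integrals against `μ⁺` and `μ⁻`. -/
noncomputable def laplace (μ : GenSignedRadonMeasure) (s : ℝ) : ℝ :=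
  (∫ x : ℝ≥0, Real.exp (-(s * (x : ℝ))) ∂μ.pos) - ∫ x : ℝ≥0, Real.exp (-(s * (x : ℝ))) ∂μ.neg

/-- The Laplace transform `Ψ_{|μ|}(s) = ∫ exp (-s x) |μ|(dx)` of `|μ|`. -/
noncomputable def laplaceAbs (μ : GenSignedRadonMeasure) (s : ℝ) : ℝ :=
  ∫ x : ℝ≥0, Real.exp (-(s * (x : ℝ))) ∂μ.variation

/-- `Ψ_μ(τ s) / Ψ_μ(τ) → 1 / s ^ ρ` as `τ ↓ 0`, for all `s > 0`. The case `s = 1` forces `Ψ_μ` to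
be nonzero near `0`. -/
def LaplaceLimit (μ : GenSignedRadonMeasure) (ρ : ℝ) : Prop :=
  ∀ s : ℝ, 0 < s →
    Tendsto (fun τ : ℝ => μ.laplace (τ * s) / μ.laplace τ) (𝓝[>] 0) (𝓝 (1 / s ^ ρ))

/-- `F_μ(t x) / F_μ(t) → x ^ ρ` as `t → ∞`, for all `x > 0`. The case `x = 1` forces `F_μ` to be
nonzero near `∞`. -/
def DistLimit (μ : GenSignedRadonMeasure) (ρ : ℝ) : Prop :=
  ∀ x : ℝ, 0 < x →
    Tendsto (fun t : ℝ => μ.distFun (t * x) / μ.distFun t) atTop (𝓝 (x ^ ρ))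

/-- `liminf_{τ ↓ 0} |Ψ_μ(τ)| / Ψ_{|μ|}(τ) > 0`. -/
def LaplaceComparable (μ : GenSignedRadonMeasure) : Prop :=
  0 < liminf (fun τ : ℝ => ((|μ.laplace τ| / μ.laplaceAbs τ : ℝ) : EReal)) (𝓝[>] 0)

/-- The Tauberian condition: for all `x > 0`,
`limsup_{h ↓ 0} limsup_{τ ↓ 0} |(F_μ((x + h) / τ) - F_μ(x / τ)) / Ψ_μ(τ)| = 0`,
with limits superior taken in the extended reals. -/
def TauberianCondition (μ : GenSignedRadonMeasure) : Prop :=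
  ∀ x : ℝ, 0 < x →
    limsup (fun h : ℝ =>
      limsup (fun τ : ℝ =>
        ((|(μ.distFun (τ⁻¹ * (x + h)) - μ.distFun (τ⁻¹ * x)) / μ.laplace τ| : ℝ) : EReal))
        (𝓝[>] 0)) (𝓝[>] 0) = 0

/-- `Ψ_μ(1 / t) ~ F_μ(t) Γ(ρ + 1)` as `t → ∞`. -/
def AsymptoticRelation (μ : GenSignedRadonMeasure) (ρ : ℝ) : Prop :=
  (fun t : ℝ => μ.laplace t⁻¹) ~[atTop] (fun t : ℝ => μ.distFun t * Real.Gamma (ρ + 1))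

end GenSignedRadonMeasure

/-!
Everything is reduced to the real function `F = F_μ`. By Tonelli's theorem
`Ψ_μ(s) = s ∫_{y > 0} exp (-s y) F(y) dy`, and Markov's inequality gives
`|F(y)| ≤ exp (s y) Ψ_{|μ|}(s)`
(`FiniteLaplace.integral_exp_mul_distFun`, `FiniteLaplace.abs_distFun_le`).

From regular variation of `F` to the Laplace transform: after the substitution `y ↦ t y`,
`Ψ_μ(1 / t) / F(t) = ∫ exp (-y) F(t y) / F(t) dy`, the integrand tends to `exp (-y) y ^ ρ`, and the
Potter-type bounds `exists_potter_bounds` give a majorant, so the limit is `Γ(ρ + 1)`. The bounds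
come from the convergence at the single ratio `2` together with boundedness on `[t, 2 t]`; the
latter holds for every measurable regularly varying function by a Steinhaus-type argument
(`exists_forall_abs_increment_le`). Monotonicity or a constant sign of `F` is not needed.

From the Laplace transform to `F`: put `G_τ(y) = F(y / τ) / Ψ_μ(τ)`. Comparability of `Ψ_μ` and
`Ψ_{|μ|}` gives `|G_τ(y)| ≤ C exp y` for small `τ`, and the hypothesis says that the Laplace
transforms of the functions `G_τ` converge to that of `y ^ ρ / Γ(ρ + 1)`. Weierstrass approximation
in the variable `exp (-y)` upgrades this to convergence of `∫ w G_τ` for every bump `w`. By the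
Tauberian condition `G_τ` is nearly constant, up to a set of small measure, on a short interval to
the right of `x`; averaging over that interval gives `G_τ(x) → x ^ ρ / Γ(ρ + 1)` for every `x > 0`
(`tendsto_zero_of_tendsto_laplace`, `LaplaceLimit.tendsto_distFun_div`). Working with the density
`F` instead of the measure `μ` makes the case `ρ = 0`, where the limit measure is a point mass, no
different from the others.
-/

/-! ### The distribution function and the Laplace transform -/

theorem IsRadonMeasure.isLocallyFiniteMeasure {m : Measure ℝ≥0} (hm : IsRadonMeasure m) :
    IsLocallyFiniteMeasure m where
  finiteAtNhds x := by
    obtain ⟨U, hU, hx, hlt⟩ := hm.locallyFinite x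
    exact ⟨U, hU.mem_nhds hx, hlt⟩

section OneMeasure

variable {m : Measure ℝ≥0}

theorem integrable_exp_neg_of_lintegral_lt_top {s : ℝ}
    (h : ∫⁻ x : ℝ≥0, ENNReal.ofReal (Real.exp (-(s * (x : ℝ)))) ∂m < ∞) :
    Integrable (fun x : ℝ≥0 => Real.exp (-(s * (x : ℝ)))) m := by
  refine ⟨by fun_prop, ?_⟩
  rw [hasFiniteIntegral_iff_ofReal (Eventually.of_forall fun x => (Real.exp_pos _).le)]
  exact h

theorem setOf_coe_le_eq_setOf_exp_neg_le {s : ℝ} (hs : 0 < s) (y : ℝ) :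
    {x : ℝ≥0 | (x : ℝ) ≤ y} =
      {x : ℝ≥0 | Real.exp (-(s * y)) ≤ Real.exp (-(s * (x : ℝ)))} := by
  ext x
  simp only [Set.mem_ofPred_eq, Real.exp_le_exp, neg_le_neg_iff]
  exact (mul_le_mul_iff_right₀ hs).symm

theorem measure_coe_le_lt_top {s : ℝ} (hs : 0 < s)
    (h : Integrable (fun x : ℝ≥0 => Real.exp (-(s * (x : ℝ)))) m) (y : ℝ) :
    m {x : ℝ≥0 | (x : ℝ) ≤ y} < ∞ := by
  rw [setOf_coe_le_eq_setOf_exp_neg_le hs]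
  exact h.measure_ge_lt_top (Real.exp_pos _)

theorem measureReal_coe_le_le_exp_mul_integral {s : ℝ} (hs : 0 < s)
    (h : Integrable (fun x : ℝ≥0 => Real.exp (-(s * (x : ℝ)))) m) (y : ℝ) :
    m.real {x : ℝ≥0 | (x : ℝ) ≤ y} ≤
      Real.exp (s * y) * ∫ x : ℝ≥0, Real.exp (-(s * (x : ℝ))) ∂m := by
  have := mul_meas_ge_le_integral_of_nonneg
    (Eventually.of_forall fun x => (Real.exp_pos _).le) h (Real.exp (-(s * y)))
  rw [← setOf_coe_le_eq_setOf_exp_neg_le hs, Real.exp_neg, inv_mul_le_iff₀ (Real.exp_pos _)] at this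
  exact this

theorem measurable_measureReal_coe_le {s : ℝ} (hs : 0 < s)
    (h : Integrable (fun x : ℝ≥0 => Real.exp (-(s * (x : ℝ)))) m) :
    Measurable fun y : ℝ => m.real {x : ℝ≥0 | (x : ℝ) ≤ y} := by
  refine Monotone.measurable fun y z hyz => ?_
  exact measureReal_mono (fun x hx => le_trans hx hyz) (measure_coe_le_lt_top hs h z).ne

theorem lintegral_Ioi_mul_exp_neg {s : ℝ} (hs : 0 < s) (x : ℝ) :
    ∫⁻ y in Set.Ioi x, ENNReal.ofReal (s * Real.exp (-(s * y))) =
      ENNReal.ofReal (Real.exp (-(s * x))) := by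
  have hi : IntegrableOn (fun y => s * Real.exp (-(s * y))) (Set.Ioi x) := by
    have : IntegrableOn (fun y => s * Real.exp (-s * y)) (Set.Ioi x) :=
      (integrableOn_exp_mul_Ioi (neg_neg_of_pos hs) x).const_mul s
    simpa only [neg_mul] using this
  rw [← ofReal_integral_eq_lintegral_ofReal hi
    (Eventually.of_forall fun y => by positivity)]
  congr 1
  have := integral_exp_mul_Ioi (neg_neg_of_pos hs) x
  simp only [neg_mul] at this
  rw [integral_const_mul, this]
  field_simp

/-- Tonelli's theorem for the Laplace transform, from
`exp (-s x) = ∫_{y > x} s exp (-s y) dy`. -/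
theorem lintegral_exp_neg_eq_lintegral_measure_coe_le [SFinite m] {s : ℝ} (hs : 0 < s) :
    ∫⁻ x : ℝ≥0, ENNReal.ofReal (Real.exp (-(s * (x : ℝ)))) ∂m =
      ∫⁻ y in Set.Ioi (0 : ℝ),
        ENNReal.ofReal (s * Real.exp (-(s * y))) * m {x : ℝ≥0 | (x : ℝ) ≤ y} := by
  have hset : MeasurableSet {p : ℝ≥0 × ℝ | (p.1 : ℝ) ≤ p.2} :=
    measurableSet_le (by fun_prop) (by fun_prop)
  calc ∫⁻ x : ℝ≥0, ENNReal.ofReal (Real.exp (-(s * (x : ℝ)))) ∂m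
      = ∫⁻ x : ℝ≥0, (∫⁻ y in Set.Ioi (0 : ℝ), {p : ℝ≥0 × ℝ | (p.1 : ℝ) ≤ p.2}.indicator
          (fun p => ENNReal.ofReal (s * Real.exp (-(s * p.2)))) (x, y)) ∂m := by
        refine lintegral_congr fun x => ?_
        rw [← lintegral_Ioi_mul_exp_neg hs, setLIntegral_congr Ioi_ae_eq_Ici]
        have : ∀ y : ℝ, {p : ℝ≥0 × ℝ | (p.1 : ℝ) ≤ p.2}.indicator
            (fun p => ENNReal.ofReal (s * Real.exp (-(s * p.2)))) (x, y) =
            (Set.Ici (x : ℝ)).indicator (fun y => ENNReal.ofReal (s * Real.exp (-(s * y)))) y := by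
          intro y
          by_cases h : (x : ℝ) ≤ y <;> simp [h]
        simp_rw [this]
        rw [setLIntegral_congr (Ioi_ae_eq_Ici (a := (0 : ℝ))), setLIntegral_indicator measurableSet_Ici,
          Set.inter_eq_left.2 (Set.Ici_subset_Ici.2 x.coe_nonneg)]
    _ = ∫⁻ y in Set.Ioi (0 : ℝ), (∫⁻ x : ℝ≥0, {p : ℝ≥0 × ℝ | (p.1 : ℝ) ≤ p.2}.indicator
          (fun p => ENNReal.ofReal (s * Real.exp (-(s * p.2)))) (x, y) ∂m) := by
        refine lintegral_lintegral_swap (Measurable.aemeasurable ?_)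
        exact Measurable.indicator (by fun_prop) hset
    _ = _ := by
        refine lintegral_congr fun y => ?_
        have : ∀ x : ℝ≥0, {p : ℝ≥0 × ℝ | (p.1 : ℝ) ≤ p.2}.indicator
            (fun p => ENNReal.ofReal (s * Real.exp (-(s * p.2)))) (x, y) =
            {x : ℝ≥0 | (x : ℝ) ≤ y}.indicator
              (fun _ => ENNReal.ofReal (s * Real.exp (-(s * y)))) x := by
          intro x
          by_cases h : (x : ℝ) ≤ y <;> simp [h]
        simp_rw [this]
        rw [lintegral_indicator_const (measurableSet_le (by fun_prop) (by fun_prop))]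

theorem integrableOn_exp_mul_measureReal_coe_le [SFinite m] {s : ℝ} (hs : 0 < s)
    (h : Integrable (fun x : ℝ≥0 => Real.exp (-(s * (x : ℝ)))) m) :
    IntegrableOn (fun y : ℝ => s * Real.exp (-(s * y)) * m.real {x : ℝ≥0 | (x : ℝ) ≤ y})
      (Set.Ioi 0) ∧
    ∫ y in Set.Ioi (0 : ℝ), s * Real.exp (-(s * y)) * m.real {x : ℝ≥0 | (x : ℝ) ≤ y} =
      ∫ x : ℝ≥0, Real.exp (-(s * (x : ℝ))) ∂m := by
  have hnn : ∀ y : ℝ, 0 ≤ s * Real.exp (-(s * y)) * m.real {x : ℝ≥0 | (x : ℝ) ≤ y} :=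
    fun y => by positivity
  have hmeas : Measurable fun y : ℝ =>
      s * Real.exp (-(s * y)) * m.real {x : ℝ≥0 | (x : ℝ) ≤ y} :=
    Measurable.mul (by fun_prop) (measurable_measureReal_coe_le hs h)
  have hofReal : ∀ y : ℝ,
      ENNReal.ofReal (s * Real.exp (-(s * y)) * m.real {x : ℝ≥0 | (x : ℝ) ≤ y}) =
      ENNReal.ofReal (s * Real.exp (-(s * y))) * m {x : ℝ≥0 | (x : ℝ) ≤ y} := fun y => by
    rw [ENNReal.ofReal_mul (by positivity),
      ofReal_measureReal (measure_coe_le_lt_top hs h y).ne]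
  have hkey := lintegral_exp_neg_eq_lintegral_measure_coe_le (m := m) hs
  simp_rw [← hofReal] at hkey
  have hlt : ∫⁻ x : ℝ≥0, ENNReal.ofReal (Real.exp (-(s * (x : ℝ)))) ∂m < ∞ :=
    (hasFiniteIntegral_iff_ofReal (Eventually.of_forall fun x => (Real.exp_pos _).le)).1 h.2
  constructor
  · refine ⟨hmeas.aestronglyMeasurable, ?_⟩
    rw [hasFiniteIntegral_iff_ofReal (Eventually.of_forall hnn), ← hkey]
    exact hlt
  · rw [integral_eq_lintegral_of_nonneg_ae (Eventually.of_forall hnn) hmeas.aestronglyMeasurable,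
      integral_eq_lintegral_of_nonneg_ae (Eventually.of_forall fun x => (Real.exp_pos _).le) h.1,
      hkey]

end OneMeasure

namespace GenSignedRadonMeasure

variable {μ : GenSignedRadonMeasure}

theorem FiniteLaplace.integrable_variation (hμ : μ.FiniteLaplace) {s : ℝ} (hs : 0 < s) :
    Integrable (fun x : ℝ≥0 => Real.exp (-(s * (x : ℝ)))) μ.variation :=
  integrable_exp_neg_of_lintegral_lt_top (hμ s hs)

theorem FiniteLaplace.integrable_pos (hμ : μ.FiniteLaplace) {s : ℝ} (hs : 0 < s) :
    Integrable (fun x : ℝ≥0 => Real.exp (-(s * (x : ℝ)))) μ.pos :=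
  (hμ.integrable_variation hs).left_of_add_measure

theorem FiniteLaplace.integrable_neg (hμ : μ.FiniteLaplace) {s : ℝ} (hs : 0 < s) :
    Integrable (fun x : ℝ≥0 => Real.exp (-(s * (x : ℝ)))) μ.neg :=
  (hμ.integrable_variation hs).right_of_add_measure

theorem FiniteLaplace.laplaceAbs_eq (hμ : μ.FiniteLaplace) {s : ℝ} (hs : 0 < s) :
    μ.laplaceAbs s = (∫ x : ℝ≥0, Real.exp (-(s * (x : ℝ))) ∂μ.pos) +
      ∫ x : ℝ≥0, Real.exp (-(s * (x : ℝ))) ∂μ.neg :=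
  integral_add_measure (hμ.integrable_pos hs) (hμ.integrable_neg hs)

theorem FiniteLaplace.distFun_of_pos (hμ : μ.FiniteLaplace) {y : ℝ} (hy : 0 < y) :
    μ.distFun y =
      μ.pos.real {x : ℝ≥0 | (x : ℝ) ≤ y} - μ.neg.real {x : ℝ≥0 | (x : ℝ) ≤ y} := by
  have h1 := measure_coe_le_lt_top one_pos (hμ.integrable_pos one_pos) y
  have h2 := measure_coe_le_lt_top one_pos (hμ.integrable_neg one_pos) y
  rw [distFun, if_neg hy.not_ge, value, if_pos ⟨h1, h2⟩, EReal.toReal_coe]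
  rfl

theorem FiniteLaplace.measurable_distFun (hμ : μ.FiniteLaplace) : Measurable μ.distFun := by
  have : μ.distFun = fun y => if y ≤ 0 then 0 else
      μ.pos.real {x : ℝ≥0 | (x : ℝ) ≤ y} - μ.neg.real {x : ℝ≥0 | (x : ℝ) ≤ y} := by
    ext y
    split_ifs with h
    · simp [distFun, h]
    · exact hμ.distFun_of_pos (not_le.1 h)
  rw [this]
  exact Measurable.ite measurableSet_Iic measurable_const
    ((measurable_measureReal_coe_le one_pos (hμ.integrable_pos one_pos)).sub
      (measurable_measureReal_coe_le one_pos (hμ.integrable_neg one_pos)))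

theorem FiniteLaplace.abs_distFun_le (hμ : μ.FiniteLaplace) {s : ℝ} (hs : 0 < s) (y : ℝ) :
    |μ.distFun y| ≤ Real.exp (s * y) * μ.laplaceAbs s := by
  rcases le_or_gt y 0 with hy | hy
  · rw [distFun, if_pos hy, abs_zero]
    exact mul_nonneg (Real.exp_pos _).le (integral_nonneg fun x => (Real.exp_pos _).le)
  · rw [hμ.distFun_of_pos hy, hμ.laplaceAbs_eq hs, mul_add, abs_le]
    have h1 := measureReal_coe_le_le_exp_mul_integral hs (hμ.integrable_pos hs) y
    have h2 := measureReal_coe_le_le_exp_mul_integral hs (hμ.integrable_neg hs) y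
    have h3 : 0 ≤ μ.pos.real {x : ℝ≥0 | (x : ℝ) ≤ y} := measureReal_nonneg
    have h4 : 0 ≤ μ.neg.real {x : ℝ≥0 | (x : ℝ) ≤ y} := measureReal_nonneg
    constructor <;> linarith

theorem FiniteLaplace.integrableOn_exp_mul_distFun_comp_mul (hμ : μ.FiniteLaplace) {s t : ℝ}
    (hs : 0 < s) (ht : 0 < t) :
    IntegrableOn (fun y => Real.exp (-(s * y)) * μ.distFun (t * y)) (Set.Ioi 0) := by
  have hFm := hμ.measurable_distFun
  -- Bounding `F_μ (t y)` by the transform at `s / (2 t)` costs only half of the decay.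
  have hi : IntegrableOn (fun y => μ.laplaceAbs (s / (2 * t)) * Real.exp (-(s / 2) * y))
      (Set.Ioi 0) := (integrableOn_exp_mul_Ioi (by linarith) 0).const_mul _
  refine Integrable.mono' hi (Measurable.aestronglyMeasurable (by fun_prop))
    (Eventually.of_forall fun y => ?_)
  have h1 := hμ.abs_distFun_le (s := s / (2 * t)) (by positivity) (t * y)
  have h2 : s / (2 * t) * (t * y) = s / 2 * y := by field_simp
  rw [h2] at h1
  have h3 : Real.exp (-(s * y)) * Real.exp (s / 2 * y) = Real.exp (-(s / 2) * y) := by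
    rw [← Real.exp_add]; ring_nf
  rw [norm_mul, Real.norm_of_nonneg (Real.exp_pos _).le, Real.norm_eq_abs]
  calc Real.exp (-(s * y)) * |μ.distFun (t * y)|
      ≤ Real.exp (-(s * y)) * (Real.exp (s / 2 * y) * μ.laplaceAbs (s / (2 * t))) := by gcongr
    _ = μ.laplaceAbs (s / (2 * t)) * (Real.exp (-(s * y)) * Real.exp (s / 2 * y)) := by ring
    _ = _ := by rw [h3]

/-- The Laplace transform of `μ` is that of the function `F_μ`, up to the factor `s`; the mass of
`μ` at `0`, which is not seen by `F_μ 0 = 0`, is seen by `F_μ y` for every `y > 0`. -/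
theorem FiniteLaplace.integral_exp_mul_distFun (hμ : μ.FiniteLaplace) {s : ℝ} (hs : 0 < s) :
    ∫ y in Set.Ioi (0 : ℝ), Real.exp (-(s * y)) * μ.distFun y = μ.laplace s / s := by
  have := μ.pos_radon.isLocallyFiniteMeasure
  have := μ.neg_radon.isLocallyFiniteMeasure
  obtain ⟨hp, hp'⟩ := integrableOn_exp_mul_measureReal_coe_le hs (hμ.integrable_pos hs)
  obtain ⟨hn, hn'⟩ := integrableOn_exp_mul_measureReal_coe_le hs (hμ.integrable_neg hs)
  rw [eq_div_iff hs.ne', laplace, ← hp', ← hn', ← integral_sub hp hn, mul_comm,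
    ← integral_const_mul]
  refine setIntegral_congr_fun measurableSet_Ioi fun y hy => ?_
  simp only [hμ.distFun_of_pos hy]
  ring

theorem FiniteLaplace.integral_exp_mul_distFun_comp_mul (hμ : μ.FiniteLaplace) {s t : ℝ}
    (hs : 0 < s) (ht : 0 < t) :
    ∫ y in Set.Ioi (0 : ℝ), Real.exp (-(s * y)) * μ.distFun (t * y) =
      μ.laplace (t⁻¹ * s) / s := by
  have h1 := integral_comp_mul_left_Ioi
    (fun y => Real.exp (-(t⁻¹ * s * y)) * μ.distFun y) 0 ht
  rw [mul_zero, hμ.integral_exp_mul_distFun (by positivity)] at h1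
  have h2 : ∀ y, t⁻¹ * s * (t * y) = s * y := fun y => by field_simp
  simp only [h2] at h1
  rw [h1, smul_eq_mul]
  field_simp

end GenSignedRadonMeasure

/-! ### Slowly and regularly varying functions -/

/-- Along a sequence tending to infinity, the increments of a slowly varying function (in additive
notation) are uniformly at most `1` on a subset of `[0, 2]` of measure more than `3 / 2`. -/
theorem exists_volume_increment_le {h : ℝ → ℝ}
    (hlim : ∀ v, Tendsto (fun u => h (u + v) - h u) atTop (𝓝 0)) {w : ℕ → ℝ}
    (hw : Tendsto w atTop atTop) :
    ∀ᶠ n in atTop, (3 / 2 : ℝ≥0∞) <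
      volume {v ∈ Set.Icc (0 : ℝ) 2 | ∀ k ≥ n, |h (w k + v) - h (w k)| ≤ 1} := by
  set V : ℕ → Set ℝ := fun n => {v ∈ Set.Icc (0 : ℝ) 2 | ∀ k ≥ n, |h (w k + v) - h (w k)| ≤ 1}
  have hmono : Monotone V := fun a b hab v hv => ⟨hv.1, fun k hk => hv.2 k (hab.trans hk)⟩
  have hun : ⋃ n, V n = Set.Icc (0 : ℝ) 2 := by
    refine Set.Subset.antisymm (Set.iUnion_subset fun n v hv => hv.1) fun v hv => ?_
    have h1 : ∀ᶠ k in atTop, |h (w k + v) - h (w k)| < 1 := by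
      have := ((hlim v).comp hw).abs
      rw [abs_zero] at this
      exact this.eventually_lt_const one_pos
    obtain ⟨n, hn⟩ := eventually_atTop.1 h1
    exact Set.mem_iUnion.2 ⟨n, hv, fun k hk => (hn k hk).le⟩
  have ht := tendsto_measure_iUnion_atTop (μ := volume) hmono
  rw [hun, Real.volume_Icc] at ht
  refine ht.eventually_const_lt ?_
  rw [sub_zero, ENNReal.ofReal_ofNat, ENNReal.div_lt_iff (by simp) (by simp)]
  norm_num

/-- Local boundedness of the increments of a measurable slowly varying function (in additive
notation). If it failed along `w n` and `w n + z n`, the two large sets of good increments based at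
these points would meet, and two good increments through a common point bound the bad one. -/
theorem exists_forall_abs_increment_le {h : ℝ → ℝ} (hm : Measurable h)
    (hlim : ∀ v, Tendsto (fun u => h (u + v) - h u) atTop (𝓝 0)) :
    ∃ U : ℝ, ∀ u ≥ U, ∀ v ∈ Set.Icc (0 : ℝ) 1, |h (u + v) - h u| ≤ 2 := by
  by_contra! hcon
  choose w hw z hz hbad using fun n : ℕ => hcon n
  have hwt : Tendsto w atTop atTop := tendsto_atTop_mono hw tendsto_natCast_atTop_atTop
  have hwt' : Tendsto (fun n => w n + z n) atTop atTop :=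
    tendsto_atTop_mono (fun n => le_add_of_nonneg_right (hz n).1) hwt
  obtain ⟨n, hn, hn'⟩ := ((exists_volume_increment_le hlim hwt).and
    (exists_volume_increment_le hlim hwt')).exists
  set A := {v ∈ Set.Icc (0 : ℝ) 2 | ∀ k ≥ n, |h (w k + v) - h (w k)| ≤ 1}
  set B := {v ∈ Set.Icc (0 : ℝ) 2 | ∀ k ≥ n, |h (w k + z k + v) - h (w k + z k)| ≤ 1}
  have hA : MeasurableSet A := by
    have : A = Set.Icc (0 : ℝ) 2 ∩ ⋂ k ≥ n, {v | |h (w k + v) - h (w k)| ≤ 1} := by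
      ext v; simp [A]
    rw [this]
    refine measurableSet_Icc.inter (MeasurableSet.iInter fun k => MeasurableSet.iInter fun _ => ?_)
    have : Measurable fun v => |h (w k + v) - h (w k)| := by fun_prop
    exact this measurableSet_Iic
  have hB : volume ((fun v => -z n + v) ⁻¹' B) = volume B := measure_preimage_add _ _ _
  obtain ⟨v, hvB, hvA⟩ := nonempty_inter_of_measure_lt_add volume
    (s := (fun v => -z n + v) ⁻¹' B) (t := A) (u := Set.Icc (0 : ℝ) 3) hA
    (fun v hv => by
      have h1 : -z n + v ∈ Set.Icc (0 : ℝ) 2 := hv.1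
      have h2 := hz n
      simp only [Set.mem_Icc] at h1 h2 ⊢
      constructor <;> linarith)
    (fun v hv => ⟨hv.1.1, hv.1.2.trans (by norm_num)⟩)
    (by
      rw [hB, Real.volume_Icc]
      refine lt_of_eq_of_lt ?_ (ENNReal.add_lt_add hn' hn)
      rw [ENNReal.div_add_div_same, sub_zero, ENNReal.ofReal_ofNat,
        ENNReal.eq_div_iff (by simp) (by simp)]
      norm_num)
  have h1 := hvA.2 n le_rfl
  have h2 := hvB.2 n le_rfl
  have h3 : w n + z n + (-z n + v) = w n + v := by ring
  rw [h3] at h2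
  have h4 := hbad n
  rw [abs_le] at h1 h2
  rcases lt_abs.1 h4 with h5 | h5 <;> linarith

/-- A measurable regularly varying function is bounded above and below on `[t, 2 t]` by multiples of
its value at `t`, uniformly for `t` large. -/
theorem exists_forall_abs_le_mul_abs {F : ℝ → ℝ} (hF : Measurable F) {ρ : ℝ}
    (hlim : ∀ x : ℝ, 0 < x → Tendsto (fun t => F (t * x) / F t) atTop (𝓝 (x ^ ρ))) :
    ∃ C : ℝ, 0 < C ∧ ∀ᶠ t in atTop, ∀ x ∈ Set.Icc (1 : ℝ) 2,
      |F (t * x)| ≤ C * |F t| ∧ |F t| ≤ C * |F (t * x)| := by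
  have hne : ∀ᶠ t in atTop, F t ≠ 0 := by
    have := (hlim 1 one_pos).eventually_ne (Real.rpow_pos_of_pos one_pos ρ).ne'
    filter_upwards [this] with t ht h0
    simp [h0] at ht
  set h : ℝ → ℝ := fun u => Real.log (F (Real.exp u)) - ρ * u
  have hm : Measurable h := by fun_prop
  have hh : ∀ v, Tendsto (fun u => h (u + v) - h u) atTop (𝓝 0) := by
    intro v
    have h1 := ((Real.continuousAt_log (Real.rpow_pos_of_pos (Real.exp_pos v) ρ).ne').tendsto.comp
      ((hlim _ (Real.exp_pos v)).comp Real.tendsto_exp_atTop)).sub_const (ρ * v)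
    rw [Real.log_rpow (Real.exp_pos v), Real.log_exp, sub_self] at h1
    refine h1.congr' ?_
    have h2 : Tendsto (fun u => Real.exp (u + v)) atTop atTop :=
      Real.tendsto_exp_atTop.comp (tendsto_atTop_add_const_right _ _ tendsto_id)
    filter_upwards [Real.tendsto_exp_atTop.eventually hne, h2.eventually hne] with u hu hv
    rw [Real.exp_add] at hv
    simp only [Function.comp_apply, h, Real.exp_add]
    rw [Real.log_div hv hu]
    ring
  obtain ⟨U, hU⟩ := exists_forall_abs_increment_le hm hh
  refine ⟨Real.exp (2 + |ρ|), Real.exp_pos _, ?_⟩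
  obtain ⟨T, hT⟩ := eventually_atTop.1 hne
  filter_upwards [eventually_ge_atTop (Real.exp U), eventually_ge_atTop T,
    eventually_gt_atTop 0] with t ht htT ht0 x hx
  have hx0 : 0 < x := by linarith [hx.1]
  have hl0 : 0 ≤ Real.log x := Real.log_nonneg hx.1
  have hl1 : Real.log x ≤ 1 := by
    have := Real.log_le_sub_one_of_pos hx0
    linarith [hx.2]
  have h1 := hU (Real.log t) ((Real.le_log_iff_exp_le ht0).2 ht) (Real.log x) ⟨hl0, hl1⟩
  simp only [h, Real.exp_add, Real.exp_log ht0, Real.exp_log hx0] at h1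
  have htne : F t ≠ 0 := hT t htT
  have htxne : F (t * x) ≠ 0 := hT _ (htT.trans (le_mul_of_one_le_right ht0.le hx.1))
  have h2 : |ρ * Real.log x| ≤ |ρ| := by
    rw [abs_mul, abs_of_nonneg hl0]
    exact mul_le_of_le_one_right (abs_nonneg ρ) hl1
  have h3 : |Real.log |F (t * x)| - Real.log (|F t|)| ≤ 2 + |ρ| := by
    rw [Real.log_abs, Real.log_abs]
    rw [abs_le] at h1 h2 ⊢
    constructor <;> linarith
  rw [abs_le] at h3
  have key : ∀ a b : ℝ, 0 < a → 0 < b → Real.log a - Real.log b ≤ 2 + |ρ| →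
      a ≤ Real.exp (2 + |ρ|) * b := by
    intro a b ha hb hab
    rw [← Real.exp_log ha, ← Real.exp_log hb, ← Real.exp_add, Real.exp_le_exp]
    linarith
  exact ⟨key _ _ (abs_pos.2 htxne) (abs_pos.2 htne) h3.2,
    key _ _ (abs_pos.2 htne) (abs_pos.2 htxne) (by linarith)⟩

/-- Potter-type bounds for a measurable function that varies regularly with index `ρ ≥ 0`: decay
from `s` to `t ≥ s` is at most like a square root, growth is at most polynomial. -/
theorem exists_potter_bounds {F : ℝ → ℝ} (hF : Measurable F) {ρ : ℝ} (hρ : 0 ≤ ρ)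
    (hlim : ∀ x : ℝ, 0 < x → Tendsto (fun t => F (t * x) / F t) atTop (𝓝 (x ^ ρ))) :
    ∃ (C : ℝ) (N : ℕ) (T : ℝ), 0 < C ∧ 0 < T ∧ ∀ s ≥ T, ∀ t ≥ s,
      |F s| ≤ C * √(t / s) * |F t| ∧ |F t| ≤ C * (t / s) ^ N * |F s| := by
  obtain ⟨C, hC, hC'⟩ := exists_forall_abs_le_mul_abs hF hlim
  obtain ⟨N, hN⟩ := exists_nat_gt ρ
  have h2ρ : (2 : ℝ) ^ ρ < 2 ^ N := by
    rw [← Real.rpow_natCast]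
    exact Real.rpow_lt_rpow_of_exponent_lt (by norm_num) hN
  have hlow : (√2)⁻¹ < (2 : ℝ) ^ ρ := by
    refine lt_of_lt_of_le (inv_lt_one_of_one_lt₀ ?_) (Real.one_le_rpow (by norm_num) hρ)
    rw [Real.lt_sqrt] <;> norm_num
  have hne : ∀ᶠ t in atTop, F t ≠ 0 := by
    have := (hlim 1 one_pos).eventually_ne (Real.rpow_pos_of_pos one_pos ρ).ne'
    filter_upwards [this] with t ht h0
    simp [h0] at ht
  have hev := (hC'.and (hne.and (((hlim 2 two_pos).eventually_lt_const h2ρ).and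
    ((hlim 2 two_pos).eventually_const_lt hlow))))
  obtain ⟨T, hT⟩ := eventually_atTop.1 (hev.and (eventually_gt_atTop 0))
  have hT0 : 0 < T := (hT T le_rfl).2
  have hpow : ∀ s ≥ T, ∀ k : ℕ, |F s| ≤ √2 ^ k * |F (s * 2 ^ k)| ∧
      |F (s * 2 ^ k)| ≤ (2 ^ k) ^ N * |F s| := by
    intro s hs k
    induction k with
    | zero => simp
    | succ k ih =>
      have hsk : T ≤ s * 2 ^ k :=
        hs.trans (le_mul_of_one_le_right (hT0.le.trans hs) (one_le_pow₀ (by norm_num)))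
      obtain ⟨⟨-, hne0, hup, hlo⟩, -⟩ := hT _ hsk
      have hpos : 0 < |F (s * 2 ^ k)| := abs_pos.2 hne0
      rw [pow_succ √2, pow_succ (2 : ℝ), ← mul_assoc s]
      have h1 : |F (s * 2 ^ k * 2)| ≤ 2 ^ N * |F (s * 2 ^ k)| := by
        rw [← div_le_iff₀ hpos, ← abs_div, abs_of_pos (lt_trans (by positivity) hlo)]
        exact hup.le
      have h2 : |F (s * 2 ^ k)| ≤ √2 * |F (s * 2 ^ k * 2)| := by
        rw [← inv_mul_le_iff₀ (by positivity), ← le_div_iff₀ hpos, ← abs_div]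
        exact hlo.le.trans (le_abs_self _)
      constructor
      · calc |F s| ≤ √2 ^ k * |F (s * 2 ^ k)| := ih.1
          _ ≤ √2 ^ k * (√2 * |F (s * 2 ^ k * 2)|) := by gcongr
          _ = _ := by ring
      · calc |F (s * 2 ^ k * 2)| ≤ 2 ^ N * |F (s * 2 ^ k)| := h1
          _ ≤ 2 ^ N * ((2 ^ k) ^ N * |F s|) := by gcongr; exact ih.2
          _ = _ := by rw [mul_pow]; ring
  refine ⟨C, N, T, hC, hT0, fun s hs t hst => ?_⟩
  have hs0 : 0 < s := hT0.trans_le hs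
  obtain ⟨k, hk, hk'⟩ := exists_nat_pow_near ((one_le_div hs0).2 hst) one_lt_two
  have hsk : T ≤ s * 2 ^ k :=
    hs.trans (le_mul_of_one_le_right hs0.le (one_le_pow₀ (by norm_num)))
  have hx : t / s / 2 ^ k ∈ Set.Icc (1 : ℝ) 2 := by
    constructor
    · rwa [one_le_div (by positivity)]
    · rw [div_le_iff₀ (by positivity), ← pow_succ']
      exact hk'.le
  have ht : s * 2 ^ k * (t / s / 2 ^ k) = t := by field_simp
  have h1 := (hT _ hsk).1.1 _ hx
  rw [ht] at h1
  have h2 := hpow s hs k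
  constructor
  · calc |F s| ≤ √2 ^ k * |F (s * 2 ^ k)| := h2.1
      _ ≤ √(t / s) * (C * |F t|) := by
        gcongr
        · refine Real.le_sqrt_of_sq_le ?_
          rwa [pow_right_comm, Real.sq_sqrt (by norm_num)]
        · exact h1.2
      _ = _ := by ring
  · calc |F t| ≤ C * |F (s * 2 ^ k)| := h1.1
      _ ≤ C * ((t / s) ^ N * |F s|) := by
        gcongr
        refine h2.2.trans ?_
        gcongr
      _ = _ := by ring

/-- The Abelian half for functions: the Laplace transform of a locally bounded function that varies
regularly with index `ρ ≥ 0`, by dominated convergence with a majorant given by the Potter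
bounds. -/
theorem tendsto_integral_exp_mul_div {F : ℝ → ℝ} (hF : Measurable F)
    (hbdd : ∀ T : ℝ, ∃ M : ℝ, ∀ y ≤ T, |F y| ≤ M) {ρ : ℝ} (hρ : 0 ≤ ρ)
    (hlim : ∀ x : ℝ, 0 < x → Tendsto (fun t => F (t * x) / F t) atTop (𝓝 (x ^ ρ))) :
    Tendsto (fun t => ∫ y in Set.Ioi (0 : ℝ), Real.exp (-y) * (F (t * y) / F t)) atTop
      (𝓝 (Real.Gamma (ρ + 1))) := by
  obtain ⟨C, N, T, hC, hT, hpot⟩ := exists_potter_bounds hF hρ hlim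
  obtain ⟨M, hM⟩ := hbdd T
  have hne : ∀ᶠ t in atTop, F t ≠ 0 := by
    have := (hlim 1 one_pos).eventually_ne (Real.rpow_pos_of_pos one_pos ρ).ne'
    filter_upwards [this] with t ht h0
    simp [h0] at ht
  have hM0 : 0 ≤ M := (abs_nonneg _).trans (hM T le_rfl)
  have hG : Real.Gamma (ρ + 1) = ∫ y in Set.Ioi (0 : ℝ), Real.exp (-y) * y ^ ρ := by
    rw [Real.Gamma_eq_integral (by positivity), add_sub_cancel_right]
  rw [hG]
  obtain ⟨t₀, ht₀⟩ := eventually_atTop.1 hne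
  -- The fixed point `t₁` has `F t₁ ≠ 0`, so that `1 / F t` grows at most like `√t`.
  set t₁ := max t₀ T
  have ht₁ : 0 < |F t₁| := abs_pos.2 (ht₀ _ (le_max_left _ _))
  have ht₁T : T ≤ t₁ := le_max_right _ _
  set A := M * (C / |F t₁|)
  have hA : 0 ≤ A := by positivity
  refine tendsto_integral_filter_of_dominated_convergence
    (fun y => (C + A) * (Real.exp (-y) * y ^ ((1 / 2 : ℝ) - 1)) +
      C * (Real.exp (-y) * y ^ ((N + 1 : ℝ) - 1))) ?_ ?_ ?_ ?_
  · refine Eventually.of_forall fun t => Measurable.aestronglyMeasurable ?_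
    fun_prop
  · filter_upwards [eventually_ge_atTop t₁] with t ht
    filter_upwards [ae_restrict_mem measurableSet_Ioi] with y hy
    have hy0 : 0 < y := hy
    have ht0 : 0 < t := hT.trans_le (ht₁T.trans ht)
    have hFt : 0 < |F t| := abs_pos.2 (ht₀ _ ((le_max_left _ _).trans ht))
    have hsq : y ^ ((1 / 2 : ℝ) - 1) = √(1 / y) := by
      rw [Real.sqrt_eq_rpow, one_div y, Real.inv_rpow hy0.le, ← Real.rpow_neg hy0.le]
      norm_num
    have hNp : y ^ ((N + 1 : ℝ) - 1) = y ^ N := by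
      rw [add_sub_cancel_right, Real.rpow_natCast]
    rw [hsq, hNp, Real.norm_eq_abs, abs_mul, abs_of_pos (Real.exp_pos _), abs_div]
    suffices hs : |F (t * y)| / |F t| ≤ (C + A) * √(1 / y) + C * y ^ N by
      calc Real.exp (-y) * (|F (t * y)| / |F t|)
          ≤ Real.exp (-y) * ((C + A) * √(1 / y) + C * y ^ N) := by gcongr
        _ = _ := by ring
    have hsq0 : 0 ≤ √(1 / y) := Real.sqrt_nonneg _
    have hyN : 0 ≤ y ^ N := by positivity
    rcases lt_or_ge (t * y) T with hlt | hge
    · have h1 : |F t₁| / (C * √(t / t₁)) ≤ |F t| := by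
        rw [div_le_iff₀' (mul_pos hC (Real.sqrt_pos.2 (by positivity)))]
        exact (hpot t₁ ht₁T t ht).1
      have h2 : √(t / t₁) ≤ √(1 / y) := by
        refine Real.sqrt_le_sqrt ?_
        rw [div_le_div_iff₀ (hT.trans_le ht₁T) hy0]
        linarith
      have hst : 0 < √(t / t₁) := Real.sqrt_pos.2 (div_pos ht0 (hT.trans_le ht₁T))
      calc |F (t * y)| / |F t| ≤ M / (|F t₁| / (C * √(t / t₁))) := by
            gcongr
            exact hM _ hlt.le
        _ = A * √(t / t₁) := by simp only [A]; field_simp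
        _ ≤ A * √(1 / y) := by gcongr
        _ ≤ _ := by nlinarith
    · rw [div_le_iff₀ hFt]
      rcases le_total y 1 with hy1 | hy1
      · have h1 := (hpot (t * y) hge t (mul_le_of_le_one_right ht0.le hy1)).1
        have h2 : t / (t * y) = 1 / y := by field_simp
        rw [h2] at h1
        refine h1.trans (mul_le_mul_of_nonneg_right ?_ hFt.le)
        nlinarith
      · have h1 := (hpot t (ht₁T.trans ht) (t * y) (le_mul_of_one_le_right ht0.le hy1)).2
        rw [mul_div_cancel_left₀ _ ht0.ne'] at h1
        refine h1.trans (mul_le_mul_of_nonneg_right ?_ hFt.le)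
        nlinarith
  · exact ((Real.GammaIntegral_convergent (by norm_num)).const_mul _).add
      ((Real.GammaIntegral_convergent (by positivity)).const_mul _)
  · filter_upwards [ae_restrict_mem measurableSet_Ioi] with y hy
    exact (hlim y hy).const_mul _

/-! ### Convergence of Laplace transforms of functions -/

theorem integrableOn_exp_mul_comp_exp_mul {g D : ℝ → ℝ} (hg : Continuous g) (hD : Measurable D)
    {C : ℝ} (hbd : ∀ y > 0, |D y| ≤ C * Real.exp y) :
    IntegrableOn (fun y => Real.exp (-(2 * y)) * g (Real.exp (-y)) * D y) (Set.Ioi 0) := by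
  obtain ⟨M, hM⟩ := isCompact_Icc.exists_bound_of_continuousOn (s := Set.Icc (0 : ℝ) 1)
    hg.continuousOn
  have hM0 : 0 ≤ M := (norm_nonneg _).trans (hM 0 (by simp))
  have hi : IntegrableOn (fun y => M * C * Real.exp (-y)) (Set.Ioi 0) :=
    (integrableOn_exp_neg_Ioi 0).const_mul _
  refine Integrable.mono' hi (Measurable.aestronglyMeasurable (by fun_prop)) ?_
  filter_upwards [ae_restrict_mem measurableSet_Ioi] with y hy
  have h1 := hM (Real.exp (-y)) ⟨(Real.exp_pos _).le, Real.exp_le_one_iff.2 (by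
    linarith [Set.mem_Ioi.1 hy])⟩
  have h2 : Real.exp (-(2 * y)) * Real.exp y = Real.exp (-y) := by
    rw [← Real.exp_add]; ring_nf
  rw [norm_mul, norm_mul, Real.norm_of_nonneg (Real.exp_pos _).le]
  calc Real.exp (-(2 * y)) * ‖g (Real.exp (-y))‖ * ‖D y‖
      ≤ Real.exp (-(2 * y)) * M * (C * Real.exp y) := by
        gcongr
        exact hbd y hy
    _ = M * C * (Real.exp (-(2 * y)) * Real.exp y) := by ring
    _ = _ := by rw [h2]

section Limit

variable {l : Filter ℝ} {D : ℝ → ℝ → ℝ} {C : ℝ}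

theorem tendsto_integral_exp_mul_polynomial (hm : ∀ τ, Measurable (D τ))
    (hbd : ∀ᶠ τ in l, ∀ y > 0, |D τ y| ≤ C * Real.exp y)
    (hlim : ∀ s : ℝ, 0 < s →
      Tendsto (fun τ => ∫ y in Set.Ioi (0 : ℝ), Real.exp (-(s * y)) * D τ y) l (𝓝 0))
    (p : Polynomial ℝ) :
    Tendsto (fun τ => ∫ y in Set.Ioi (0 : ℝ),
      Real.exp (-(2 * y)) * p.eval (Real.exp (-y)) * D τ y) l (𝓝 0) := by
  induction p using Polynomial.induction_on' with
  | add p q hp hq =>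
    have := hp.add hq
    rw [add_zero] at this
    refine this.congr' ?_
    filter_upwards [hbd] with τ hτ
    rw [← integral_add (integrableOn_exp_mul_comp_exp_mul p.continuous (hm τ) hτ)
      (integrableOn_exp_mul_comp_exp_mul q.continuous (hm τ) hτ)]
    refine integral_congr_ae (Eventually.of_forall fun y => ?_)
    simp only [Polynomial.eval_add]
    ring
  | monomial n a =>
    have := (hlim (n + 2) (by positivity)).const_mul a
    rw [mul_zero] at this
    refine this.congr fun τ => ?_
    rw [← integral_const_mul]
    refine integral_congr_ae (Eventually.of_forall fun y => ?_)
    have h1 : Real.exp (-(((n : ℝ) + 2) * y)) = Real.exp (-(2 * y)) * Real.exp (-y) ^ n := by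
      rw [← Real.exp_nat_mul, ← Real.exp_add]; ring_nf
    simp only [Polynomial.eval_monomial, h1]
    ring

/-- Weierstrass approximation in the variable `exp (-y)`. -/
theorem tendsto_integral_exp_mul_comp_exp (hm : ∀ τ, Measurable (D τ))
    (hbd : ∀ᶠ τ in l, ∀ y > 0, |D τ y| ≤ C * Real.exp y)
    (hlim : ∀ s : ℝ, 0 < s →
      Tendsto (fun τ => ∫ y in Set.Ioi (0 : ℝ), Real.exp (-(s * y)) * D τ y) l (𝓝 0))
    {f : ℝ → ℝ} (hf : Continuous f) :
    Tendsto (fun τ => ∫ y in Set.Ioi (0 : ℝ),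
      Real.exp (-(2 * y)) * f (Real.exp (-y)) * D τ y) l (𝓝 0) := by
  rw [Metric.tendsto_nhds]
  intro ε hε
  set η := ε / (2 * (|C| + 1))
  have hη : 0 < η := by positivity
  obtain ⟨p, hp⟩ := exists_polynomial_near_of_continuousOn 0 1 f hf.continuousOn η hη
  have h1 := (Metric.tendsto_nhds.1 (tendsto_integral_exp_mul_polynomial hm hbd hlim p))
    (ε / 2) (by positivity)
  filter_upwards [h1, hbd] with τ h1 hτ
  rw [Real.dist_eq, sub_zero] at h1 ⊢
  have hfi := integrableOn_exp_mul_comp_exp_mul hf (hm τ) hτ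
  have hpi := integrableOn_exp_mul_comp_exp_mul p.continuous (hm τ) hτ
  have h2 : |∫ y in Set.Ioi (0 : ℝ), (Real.exp (-(2 * y)) * f (Real.exp (-y)) * D τ y -
      Real.exp (-(2 * y)) * p.eval (Real.exp (-y)) * D τ y)| ≤
      ∫ y in Set.Ioi (0 : ℝ), η * |C| * Real.exp (-y) := by
    rw [← Real.norm_eq_abs]
    refine norm_integral_le_of_norm_le ((integrableOn_exp_neg_Ioi 0).const_mul _) ?_
    filter_upwards [ae_restrict_mem measurableSet_Ioi] with y hy
    have h3 := hp (Real.exp (-y)) ⟨(Real.exp_pos _).le, Real.exp_le_one_iff.2 (by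
      linarith [Set.mem_Ioi.1 hy])⟩
    have h4 : Real.exp (-(2 * y)) * Real.exp y = Real.exp (-y) := by
      rw [← Real.exp_add]; ring_nf
    rw [← sub_mul, ← mul_sub, Real.norm_eq_abs, abs_mul, abs_mul, abs_of_pos (Real.exp_pos _),
      abs_sub_comm]
    calc Real.exp (-(2 * y)) * |p.eval (Real.exp (-y)) - f (Real.exp (-y))| * |D τ y|
        ≤ Real.exp (-(2 * y)) * η * (|C| * Real.exp y) := by
          gcongr
          refine (hτ y hy).trans ?_
          gcongr
          exact le_abs_self C
      _ = η * |C| * (Real.exp (-(2 * y)) * Real.exp y) := by ring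
      _ = _ := by rw [h4]
  rw [integral_sub hfi hpi, integral_const_mul, integral_exp_neg_Ioi_zero, mul_one] at h2
  have h5 : η * |C| < ε / 2 := by
    have : η * (|C| + 1) = ε / 2 := by simp only [η]; field_simp
    linarith
  rw [abs_le] at h2
  rw [abs_lt] at h1 ⊢
  constructor <;> linarith

/-- The Tauberian half for functions: if the Laplace transforms of `D τ` tend to `0` and `D τ` does
not oscillate much to the right of `x`, then `D τ x` tends to `0`. The average of `D τ` with
respect to a bump supported in `[x, x + h]` tends to `0`, and differs little from `D τ x`. -/
theorem tendsto_zero_of_tendsto_laplace [l.IsCountablyGenerated] (hm : ∀ τ, Measurable (D τ))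
    (hbd : ∀ᶠ τ in l, ∀ y > 0, |D τ y| ≤ C * Real.exp y)
    (hlim : ∀ s : ℝ, 0 < s →
      Tendsto (fun τ => ∫ y in Set.Ioi (0 : ℝ), Real.exp (-(s * y)) * D τ y) l (𝓝 0))
    {x : ℝ} (hx : 0 < x)
    (hosc : ∀ ε > 0, ∀ᶠ h in 𝓝[>] (0 : ℝ), ∀ᶠ τ in l, |D τ (x + h) - D τ x| ≤ ε) :
    Tendsto (fun τ => D τ x) l (𝓝 0) := by
  rw [Metric.tendsto_nhds]
  intro ε hε
  obtain ⟨δ, hδ, hosc⟩ := mem_nhdsGT_iff_exists_Ioo_subset.1 (hosc (ε / 4) (by positivity))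
  rw [Set.mem_Ioi] at hδ
  set f : ℝ → ℝ := fun z =>
    max 0 (min (z - Real.exp (-(x + δ))) (Real.exp (-x) - z)) with hfdef
  have hf : Continuous f := by fun_prop
  have hf0 : ∀ z, 0 ≤ f z := fun z => le_max_left _ _
  have hf_pos : ∀ y ∈ Set.Ioo x (x + δ), 0 < f (Real.exp (-y)) := fun y hy => by
    refine lt_max_of_lt_right (lt_min ?_ ?_) <;> rw [sub_pos, Real.exp_lt_exp] <;>
      linarith [hy.1, hy.2]
  have hf_zero : ∀ y ∉ Set.Ioo x (x + δ), f (Real.exp (-y)) = 0 := fun y hy => by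
    refine max_eq_left ?_
    rcases le_or_gt y x with h | h
    · refine (min_le_right _ _).trans ?_
      rw [sub_nonpos, Real.exp_le_exp]; linarith
    · refine (min_le_left _ _).trans ?_
      have : x + δ ≤ y := not_lt.1 fun h' => hy ⟨h, h'⟩
      rw [sub_nonpos, Real.exp_le_exp]; linarith
  set w : ℝ → ℝ := fun y => Real.exp (-(2 * y)) * f (Real.exp (-y))
  have hw0 : ∀ y, 0 ≤ w y := fun y => mul_nonneg (Real.exp_pos _).le (hf0 _)
  have hwi : ∀ {E : ℝ → ℝ} (_ : Measurable E) {c : ℝ} (_ : ∀ y > 0, |E y| ≤ c * Real.exp y),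
      IntegrableOn (fun y => w y * E y) (Set.Ioi 0) := fun hE _ hc =>
    integrableOn_exp_mul_comp_exp_mul hf hE hc
  have hwc : ∀ c : ℝ, IntegrableOn (fun y => w y * c) (Set.Ioi 0) := fun c =>
    hwi (c := |c|) measurable_const fun y hy =>
      le_mul_of_one_le_right (abs_nonneg c) (Real.one_le_exp (le_of_lt hy))
  set W := ∫ y in Set.Ioi (0 : ℝ), w y
  have hwW : IntegrableOn w (Set.Ioi 0) := by simpa using hwc 1
  have hW : 0 < W := by
    rw [setIntegral_pos_iff_support_of_nonneg_ae (Eventually.of_forall hw0) hwW]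
    refine lt_of_lt_of_le ?_ (measure_mono (s := Set.Ioo x (x + δ)) fun y hy =>
      ⟨(mul_pos (Real.exp_pos _) (hf_pos y hy)).ne', hx.trans hy.1⟩)
    rw [Real.volume_Ioo]
    exact ENNReal.ofReal_pos.2 (by linarith)
  have h1 := (Metric.tendsto_nhds.1 (tendsto_integral_exp_mul_comp_exp hm hbd hlim hf))
    (W * (ε / 4)) (by positivity)
  -- The excess of the oscillation over `ε / 4` tends to `0` pointwise and boundedly.
  have h2 : Tendsto (fun τ => ∫ y in Set.Ioi (0 : ℝ), w y * max (|D τ y - D τ x| - ε / 4) 0) l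
      (𝓝 (∫ y in Set.Ioi (0 : ℝ), (0 : ℝ))) := by
    refine tendsto_integral_filter_of_dominated_convergence
      (fun y => w y * (C * Real.exp y + C * Real.exp x)) ?_ ?_ ?_ ?_
    · exact Eventually.of_forall fun τ => Measurable.aestronglyMeasurable
        (by have := hm τ; fun_prop)
    · filter_upwards [hbd] with τ hτ
      filter_upwards [ae_restrict_mem measurableSet_Ioi] with y hy
      rw [norm_mul, Real.norm_of_nonneg (hw0 y), Real.norm_of_nonneg (le_max_right _ _)]
      refine mul_le_mul_of_nonneg_left (max_le ?_ ?_) (hw0 y)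
      · have h3 := abs_sub (D τ y) (D τ x)
        have h4 := hτ y hy
        have h5 := hτ x hx
        linarith
      · exact add_nonneg ((abs_nonneg _).trans (hτ y hy)) ((abs_nonneg _).trans (hτ x hx))
    · have := (hwi (E := fun y => C * Real.exp y) (by fun_prop) (c := |C|) fun y _ => by
        rw [abs_mul, abs_of_pos (Real.exp_pos y)]).add (hwc (C * Real.exp x))
      refine this.congr (Eventually.of_forall fun y => ?_)
      simp only [Pi.add_apply]
      ring
    · refine Eventually.of_forall fun y => ?_
      by_cases hy : y ∈ Set.Ioo x (x + δ)
      · have h3 : ∀ᶠ τ in l, |D τ (x + (y - x)) - D τ x| ≤ ε / 4 :=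
          hosc ⟨by linarith [hy.1], by linarith [hy.2]⟩
        refine tendsto_const_nhds.congr' ?_
        filter_upwards [h3] with τ hτ
        rw [add_sub_cancel] at hτ
        rw [max_eq_right (by linarith), mul_zero]
      · simp only [w, hf_zero y hy, mul_zero, zero_mul]
        exact tendsto_const_nhds
  rw [integral_zero] at h2
  have h2 := (Metric.tendsto_nhds.1 h2) (W * (ε / 4)) (by positivity)
  filter_upwards [h1, h2, hbd] with τ h1 h2 hτ
  rw [Real.dist_eq, sub_zero] at h1 h2 ⊢
  have hD := hwi (hm τ) hτ
  have hE : IntegrableOn (fun y => w y * max (|D τ y - D τ x| - ε / 4) 0) (Set.Ioi 0) := by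
    refine hwi (by have := hm τ; fun_prop) (c := C + |D τ x|) fun y hy => ?_
    rw [abs_of_nonneg (le_max_right _ _)]
    have h3 := abs_sub (D τ y) (D τ x)
    have h4 := hτ y hy
    have h5 : |D τ x| ≤ |D τ x| * Real.exp y :=
      le_mul_of_one_le_right (abs_nonneg _) (Real.one_le_exp (le_of_lt hy))
    have h6 := abs_nonneg (D τ y)
    have h7 := abs_nonneg (D τ x)
    refine max_le ?_ ?_ <;> linarith
  have h3 : |∫ y in Set.Ioi (0 : ℝ), (w y * D τ y - w y * D τ x)| ≤
      ∫ y in Set.Ioi (0 : ℝ), (w y * (ε / 4) + w y * max (|D τ y - D τ x| - ε / 4) 0) := by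
    rw [← Real.norm_eq_abs]
    refine norm_integral_le_of_norm_le ((hwc _).add hE) (Eventually.of_forall fun y => ?_)
    rw [← mul_sub, ← mul_add, norm_mul, Real.norm_of_nonneg (hw0 y), Real.norm_eq_abs]
    refine mul_le_mul_of_nonneg_left ?_ (hw0 y)
    linarith [le_max_left (|D τ y - D τ x| - ε / 4) 0]
  rw [integral_sub hD (hwc _), integral_add (hwc _) hE, integral_mul_const, integral_mul_const]
    at h3
  change |(∫ y in Set.Ioi (0 : ℝ), w y * D τ y) - W * D τ x| ≤ W * (ε / 4) + _ at h3
  have h4 : |W * D τ x| ≤ W * (3 * (ε / 4)) := by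
    rw [abs_lt] at h1 h2
    rw [abs_le] at h3 ⊢
    change _ < (∫ y in Set.Ioi (0 : ℝ), w y * D τ y) ∧ (∫ y in Set.Ioi (0 : ℝ), w y * D τ y) < _
      at h1
    constructor <;> linarith
  rw [abs_mul, abs_of_pos hW] at h4
  have := le_of_mul_le_mul_left h4 hW
  linarith

end Limit

/-! ### Karamata's theorem -/

theorem rpow_le_mul_exp {ρ : ℝ} (hρ : 0 ≤ ρ) {y : ℝ} (hy : 0 < y) :
    y ^ ρ ≤ (ρ + 1) ^ ρ * Real.exp y := by
  have h1 : y / (ρ + 1) ≤ Real.exp (y / (ρ + 1)) := by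
    linarith [Real.add_one_le_exp (y / (ρ + 1))]
  calc y ^ ρ = (ρ + 1) ^ ρ * (y / (ρ + 1)) ^ ρ := by
        rw [← Real.mul_rpow (by positivity) (by positivity)]
        congr 1
        field_simp
    _ ≤ (ρ + 1) ^ ρ * Real.exp (y / (ρ + 1)) ^ ρ := by gcongr
    _ ≤ (ρ + 1) ^ ρ * Real.exp y := by
        rw [← Real.exp_mul]
        gcongr
        rw [div_mul_eq_mul_div, div_le_iff₀ (by positivity)]
        nlinarith

namespace GenSignedRadonMeasure

variable {μ : GenSignedRadonMeasure} {ρ : ℝ}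

theorem asymptoticRelation_of_tendsto (hρ : 0 ≤ ρ)
    (h : Tendsto (fun t => μ.laplace t⁻¹ / μ.distFun t) atTop (𝓝 (Real.Gamma (ρ + 1)))) :
    μ.AsymptoticRelation ρ := by
  have hΓ : Real.Gamma (ρ + 1) ≠ 0 := (Real.Gamma_pos_of_pos (by positivity)).ne'
  have hne : ∀ᶠ t in atTop, μ.distFun t ≠ 0 := by
    filter_upwards [h.eventually_ne hΓ] with t ht h0
    simp [h0] at ht
  rw [AsymptoticRelation, isEquivalent_iff_tendsto_one
    (hne.mono fun t ht => mul_ne_zero ht hΓ)]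
  have h1 := h.div_const (Real.Gamma (ρ + 1))
  rw [div_self hΓ] at h1
  exact h1.congr fun t => div_div _ _ _

theorem DistLimit.tendsto_laplace_div (hμ : μ.FiniteLaplace) (hρ : 0 ≤ ρ) (h : μ.DistLimit ρ) :
    Tendsto (fun t => μ.laplace t⁻¹ / μ.distFun t) atTop (𝓝 (Real.Gamma (ρ + 1))) := by
  have hbdd : ∀ T : ℝ, ∃ M : ℝ, ∀ y ≤ T, |μ.distFun y| ≤ M := fun T => by
    refine ⟨Real.exp (1 * T) * μ.laplaceAbs 1, fun y hy =>
      (hμ.abs_distFun_le one_pos y).trans ?_⟩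
    have : 0 ≤ μ.laplaceAbs 1 := integral_nonneg fun x => (Real.exp_pos _).le
    gcongr
  refine (tendsto_integral_exp_mul_div hμ.measurable_distFun hbdd hρ h).congr' ?_
  filter_upwards [eventually_gt_atTop 0] with t ht
  have h1 := hμ.integral_exp_mul_distFun_comp_mul one_pos ht
  simp only [one_mul, mul_one, div_one] at h1
  simp only [← mul_div_assoc]
  rw [integral_div, h1]

theorem DistLimit.laplaceLimit (hμ : μ.FiniteLaplace) (hρ : 0 ≤ ρ) (h : μ.DistLimit ρ) :
    μ.LaplaceLimit ρ := by
  intro s hs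
  have hΓ : Real.Gamma (ρ + 1) ≠ 0 := (Real.Gamma_pos_of_pos (by positivity)).ne'
  have hA := h.tendsto_laplace_div hμ hρ
  have hne : ∀ᶠ t in atTop, μ.distFun t ≠ 0 := by
    filter_upwards [hA.eventually_ne hΓ] with t ht h0
    simp [h0] at ht
  have hs' : Tendsto (fun t : ℝ => t * s⁻¹) atTop atTop :=
    tendsto_id.atTop_mul_const (inv_pos.2 hs)
  have h1 := (((hA.comp hs').mul (h s⁻¹ (inv_pos.2 hs))).div hA hΓ).comp
    tendsto_inv_nhdsGT_zero
  have h2 : Real.Gamma (ρ + 1) * s⁻¹ ^ ρ / Real.Gamma (ρ + 1) = 1 / s ^ ρ := by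
    rw [Real.inv_rpow hs.le]
    field_simp
  rw [h2] at h1
  refine h1.congr' ?_
  filter_upwards [tendsto_inv_nhdsGT_zero.eventually hne,
    tendsto_inv_nhdsGT_zero.eventually (hs'.eventually hne)] with τ hτ hτ'
  simp only [Function.comp_apply, Pi.div_apply, mul_inv, inv_inv]
  rw [div_mul_div_cancel₀ hτ', div_div_div_cancel_right₀ hτ]

theorem LaplaceComparable.exists_laplaceAbs_le (h : μ.LaplaceComparable) :
    ∃ C : ℝ, 0 < C ∧ ∀ᶠ τ in 𝓝[>] (0 : ℝ), μ.laplaceAbs τ ≤ C * |μ.laplace τ| := by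
  obtain ⟨c, hc, hc'⟩ := EReal.lt_iff_exists_real_btwn.1 h
  have hc0 : 0 < c := EReal.coe_pos.1 hc
  refine ⟨c⁻¹, inv_pos.2 hc0, ?_⟩
  filter_upwards [eventually_lt_of_lt_liminf hc'] with τ hτ
  have h1 : c < |μ.laplace τ| / μ.laplaceAbs τ := EReal.coe_lt_coe_iff.1 hτ
  have h2 : 0 ≤ μ.laplaceAbs τ := integral_nonneg fun x => (Real.exp_pos _).le
  have h3 : 0 < μ.laplaceAbs τ := by
    refine lt_of_le_of_ne h2 fun h0 => ?_
    rw [← h0, div_zero] at h1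
    linarith
  rw [lt_div_iff₀ h3] at h1
  rw [le_inv_mul_iff₀ hc0]
  exact h1.le

theorem TauberianCondition.eventually_le (h : μ.TauberianCondition) {x : ℝ} (hx : 0 < x) {ε : ℝ}
    (hε : 0 < ε) : ∀ᶠ h in 𝓝[>] (0 : ℝ), ∀ᶠ τ in 𝓝[>] (0 : ℝ),
      |(μ.distFun (τ⁻¹ * (x + h)) - μ.distFun (τ⁻¹ * x)) / μ.laplace τ| ≤ ε := by
  have h1 := eventually_lt_of_limsup_lt ((h x hx).trans_lt (EReal.coe_pos.2 hε))
  filter_upwards [h1] with h hh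
  filter_upwards [eventually_lt_of_limsup_lt hh] with τ hτ
  exact (EReal.coe_lt_coe_iff.1 hτ).le

/-- The Tauberian limit: the rescaled distribution functions converge pointwise. -/
theorem LaplaceLimit.tendsto_distFun_div (hμ : μ.FiniteLaplace) (hρ : 0 ≤ ρ)
    (hcomp : μ.LaplaceComparable) (htaub : μ.TauberianCondition) (h : μ.LaplaceLimit ρ)
    {x : ℝ} (hx : 0 < x) :
    Tendsto (fun τ => μ.distFun (τ⁻¹ * x) / μ.laplace τ) (𝓝[>] 0)
      (𝓝 (x ^ ρ / Real.Gamma (ρ + 1))) := by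
  have hΓ : 0 < Real.Gamma (ρ + 1) := Real.Gamma_pos_of_pos (by positivity)
  obtain ⟨C, hC, hC'⟩ := hcomp.exists_laplaceAbs_le
  have hne : ∀ᶠ τ in 𝓝[>] (0 : ℝ), μ.laplace τ ≠ 0 := by
    filter_upwards [(h 1 one_pos).eventually_ne (b₂ := 0) (by simp)] with τ hτ h0
    simp [h0] at hτ
  have hFm := hμ.measurable_distFun
  set D : ℝ → ℝ → ℝ := fun τ y =>
    μ.distFun (τ⁻¹ * y) / μ.laplace τ - y ^ ρ / Real.Gamma (ρ + 1)
  have hbd1 : ∀ᶠ τ in 𝓝[>] (0 : ℝ), ∀ y > 0,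
      |μ.distFun (τ⁻¹ * y) / μ.laplace τ| ≤ C * Real.exp y := by
    filter_upwards [hne, hC', self_mem_nhdsWithin] with τ hτ hτC hτ0 y hy
    have hτ0 : 0 < τ := hτ0
    have h1 := hμ.abs_distFun_le hτ0 (τ⁻¹ * y)
    rw [mul_inv_cancel_left₀ hτ0.ne'] at h1
    rw [abs_div, div_le_iff₀ (abs_pos.2 hτ)]
    calc _ ≤ _ := h1
      _ ≤ Real.exp y * (C * |μ.laplace τ|) := by gcongr
      _ = _ := by ring
  have hbd2 : ∀ y > 0, |y ^ ρ / Real.Gamma (ρ + 1)| ≤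
      (ρ + 1) ^ ρ / Real.Gamma (ρ + 1) * Real.exp y := fun y hy => by
    rw [abs_of_nonneg (div_nonneg (Real.rpow_nonneg (le_of_lt hy) _) hΓ.le), div_mul_eq_mul_div]
    gcongr
    exact rpow_le_mul_exp hρ hy
  have hDlim : Tendsto (fun τ => D τ x) (𝓝[>] 0) (𝓝 0) := by
    refine tendsto_zero_of_tendsto_laplace (C := C + (ρ + 1) ^ ρ / Real.Gamma (ρ + 1))
      (fun τ => by fun_prop) ?_ ?_ hx ?_
    · filter_upwards [hbd1] with τ hτ y hy
      rw [add_mul]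
      exact (abs_sub _ _).trans (add_le_add (hτ y hy) (hbd2 y hy))
    · intro s hs
      have hr := Real.integral_rpow_mul_exp_neg_mul_Ioi (a := ρ + 1) (by positivity) hs
      rw [add_sub_cancel_right] at hr
      have h1 := (h s hs).div_const s
      have h2 := h1.sub_const (1 / s ^ ρ / s)
      rw [sub_self] at h2
      refine h2.congr' ?_
      filter_upwards [self_mem_nhdsWithin] with τ hτ0
      have hτ0 : 0 < τ := hτ0
      have h3 := hμ.integral_exp_mul_distFun_comp_mul hs (inv_pos.2 hτ0)
      rw [inv_inv] at h3
      have hi1 : IntegrableOn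
          (fun y => Real.exp (-(s * y)) * (μ.distFun (τ⁻¹ * y) / μ.laplace τ)) (Set.Ioi 0) := by
        simp only [← mul_div_assoc]
        exact (hμ.integrableOn_exp_mul_distFun_comp_mul hs (inv_pos.2 hτ0)).div_const _
      have hi2 : IntegrableOn
          (fun y => Real.exp (-(s * y)) * (y ^ ρ / Real.Gamma (ρ + 1))) (Set.Ioi 0) := by
        have := (integrableOn_rpow_mul_exp_neg_mul_rpow (s := ρ) (by linarith) one_pos
          hs).div_const (Real.Gamma (ρ + 1))
        refine this.congr (Eventually.of_forall fun y => ?_)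
        simp only [Real.rpow_one, neg_mul]
        ring
      simp only [D, mul_sub]
      rw [integral_sub hi1 hi2]
      congr 1
      · simp only [← mul_div_assoc]
        rw [integral_div, h3]
        ring
      · have h4 : ∀ y : ℝ, Real.exp (-(s * y)) * (y ^ ρ / Real.Gamma (ρ + 1)) =
            y ^ ρ * Real.exp (-(s * y)) / Real.Gamma (ρ + 1) := fun y => by ring
        simp only [h4]
        rw [integral_div, hr, mul_div_cancel_right₀ _ hΓ.ne', Real.div_rpow zero_le_one hs.le,
          Real.one_rpow, Real.rpow_add_one hs.ne', div_div]
    · intro ε hε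
      have hcont : Tendsto (fun h : ℝ => (x + h) ^ ρ / Real.Gamma (ρ + 1)) (𝓝[>] 0)
          (𝓝 (x ^ ρ / Real.Gamma (ρ + 1))) := by
        have h1 : ContinuousAt (fun h : ℝ => (x + h) ^ ρ / Real.Gamma (ρ + 1)) 0 := by
          refine ContinuousAt.div_const (ContinuousAt.rpow_const (by fun_prop) (Or.inr hρ)) _
        have h2 := h1.tendsto
        rw [add_zero] at h2
        exact h2.mono_left nhdsWithin_le_nhds
      have h2 := (Metric.tendsto_nhds.1 hcont) (ε / 2) (by positivity)
      filter_upwards [h2, htaub.eventually_le hx (half_pos hε)] with h h2 h3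
      filter_upwards [h3] with τ h3
      rw [Real.dist_eq, abs_lt] at h2
      rw [sub_div, abs_le] at h3
      simp only [D]
      rw [abs_le]
      constructor <;> linarith
  have := hDlim.add_const (x ^ ρ / Real.Gamma (ρ + 1))
  simpa only [D, sub_add_cancel, zero_add] using this

end GenSignedRadonMeasure

theorem mainTheorem2 (μ : GenSignedRadonMeasure) (hμ : μ.FiniteLaplace) (ρ : ℝ) (hρ : 0 ≤ ρ) :
    (μ.LaplaceComparable → μ.TauberianCondition → μ.LaplaceLimit ρ →
      μ.DistLimit ρ ∧ μ.AsymptoticRelation ρ) ∧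
    (μ.DistLimit ρ → μ.LaplaceLimit ρ ∧ μ.AsymptoticRelation ρ) := by
  refine ⟨fun hcomp htaub h => ?_, fun h => ⟨h.laplaceLimit hμ hρ,
    GenSignedRadonMeasure.asymptoticRelation_of_tendsto hρ (h.tendsto_laplace_div hμ hρ)⟩⟩
  have hΓ : 0 < Real.Gamma (ρ + 1) := Real.Gamma_pos_of_pos (by positivity)
  have hlim := fun (x : ℝ) (hx : 0 < x) =>
    (h.tendsto_distFun_div hμ hρ hcomp htaub hx).comp tendsto_inv_atTop_nhdsGT_zero
  have h1 := hlim 1 one_pos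
  simp only [Function.comp_def, inv_inv, mul_one, Real.one_rpow] at h1 hlim
  have h1ne : 1 / Real.Gamma (ρ + 1) ≠ 0 := by positivity
  constructor
  · intro x hx
    have h2 := (hlim x hx).div h1 h1ne
    have h3 : x ^ ρ / Real.Gamma (ρ + 1) / (1 / Real.Gamma (ρ + 1)) = x ^ ρ := by field_simp
    rw [h3] at h2
    refine h2.congr' ?_
    filter_upwards [h1.eventually_ne h1ne] with t ht
    have ht' : μ.laplace t⁻¹ ≠ 0 := fun h0 => by simp [h0] at ht
    exact div_div_div_cancel_right₀ ht' _ _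
  · refine GenSignedRadonMeasure.asymptoticRelation_of_tendsto hρ ?_
    have h2 := h1.inv₀ h1ne
    simpa only [inv_div, div_one] using h2
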